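/- Let $\mathcal{C}$ be a category with finite products and weak pullbacks. A class $\mathcal{S}$ of morphisms of $\mathcal{C}$ is a *system of covers* if it contains all identities, is closed under composition and under products ($f,g\in\mathcal{S}$ implies $f\times g\in\mathcal{S}$), is closed under weak pullback (the projection of any weak pullback of $\pi\in\mathcal{S}$ along any morphism, parallel to $\pi$, lies in $\mathcal{S}$), and satisfies: if $\pi\circ f\in\mathcal{S}$ then $\pi\in\mathcal{S}$. A *cartesian bicategory* is a symmetric monoidal category enriched over posets in which every object carries a chosen cocommutative comonoid whose comultiplication and counit have right adjoints, such that the Frobenius law holds, every morphism is a lax comonoid homomorphism, and the comonoids are compatible with the monoidal structure. A morphism of cartesian bicategories is a (strong symmetric) monoidal functor preserving the ordering, the comonoids and the right-adjoint monoids. Write $\mathsf{Span}^{\sim}(\mathcal{C})$ for the cartesian bicategory with the objects of $\mathcal{C}$, whose morphisms $X\to Y$ are spans $X\leftarrow A\to Y$ modulo the equivalence relation $\le\cap\ge$ of the following preorder (which also induces the ordering): $(X\leftarrow A\to Y)\le(X\leftarrow B\to Y)$ if there is a morphism $A\to B$ commuting with the legs. For a system of covers $\mathcal{S}$, $\mathsf{Span}^{\mathcal{S}}(\mathcal{C})$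 is defined in the same way from the preorder: $(X\leftarrow A\to Y)\le(X\leftarrow B\to Y)$ if there are a morphism $\pi\colon A'\to A$ in $\mathcal{S}$ and a morphism $\alpha\colon A'\to B$ such that the two composites $A'\to X$ agree and the two composites $A'\to Y$ agree. In both, composition is by weak pullback, identities are the identity spans, the monoidal product is the product of $\mathcal{C}$ with the terminal object $1$ as unit, comultiplication and counit on $X$ are the classes of $X\xleftarrow{\mathrm{id}}X\xrightarrow{\Delta}X\times X$ and $X\xleftarrow{\mathrm{id}}X\to 1$, and their right adjoints are the classes of the reversed spans. Then the split epimorphisms of $\mathcal{C}$ form the smallest system of covers on $\mathcal{C}$: they are a system of covers, and they are contained in every system of covers. Moreover, taking $\mathcal{S}$ to be the class of split epimorphisms, there is an isomorphism of cartesian bicategories $$\mathsf{Span}^{\sim}(\mathcal{C})\cong\mathsf{Span}^{\mathcal{S}}(\mathcal{C}).$$ -/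

import Mathlib

open CategoryTheory MonoidalCategory CartesianMonoidalCategory Limits

universe v u

/-! ### Cartesian bicategories -/

/-- A cartesian bicategory (of relations): a symmetric monoidal category enriched over posets,
with a chosen commutative comonoid on every object whose structure morphisms have right adjoints
`cocopy` and `codiscard`, satisfying the Frobenius law, such that every morphism is a lax comonoid
homomorphism and the comonoids are compatible with the monoidal structure.
Copying is `ComonObj.comul : X ⟶ X ⊗ X`, discarding is `ComonObj.counit : X ⟶ 𝟙_ B`. -/
class CartesianBicategory (B : Type u) [Category.{v} B] [MonoidalCategory B]
    [SymmetricCategory B] where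
  [homOrder : ∀ X Y : B, PartialOrder (X ⟶ Y)]
  comp_mono : ∀ {X Y Z : B} {f f₁ : X ⟶ Y} {g g₁ : Y ⟶ Z}, f ≤ f₁ → g ≤ g₁ → f ≫ g ≤ f₁ ≫ g₁
  tensor_mono : ∀ {X Y Z W : B} {f f₁ : X ⟶ Y} {g g₁ : Z ⟶ W},
    f ≤ f₁ → g ≤ g₁ → f ⊗ₘ g ≤ f₁ ⊗ₘ g₁
  [comon : ∀ X : B, ComonObj X]
  [comm : ∀ X : B, IsCommComonObj X]
  cocopy : ∀ X : B, X ⊗ X ⟶ X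
  codiscard : ∀ X : B, 𝟙_ B ⟶ X
  unit_copy : ∀ X : B, 𝟙 X ≤ ComonObj.comul ≫ cocopy X
  counit_copy : ∀ X : B, cocopy X ≫ ComonObj.comul ≤ 𝟙 (X ⊗ X)
  unit_discard : ∀ X : B, 𝟙 X ≤ ComonObj.counit ≫ codiscard X
  counit_discard : ∀ X : B, codiscard X ≫ ComonObj.counit ≤ 𝟙 (𝟙_ B)
  frobenius_left : ∀ X : B,
    (X ◁ ComonObj.comul) ≫ (α_ X X X).inv ≫ (cocopy X ▷ X) = cocopy X ≫ ComonObj.comul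
  frobenius_right : ∀ X : B,
    (ComonObj.comul ▷ X) ≫ (α_ X X X).hom ≫ (X ◁ cocopy X) = cocopy X ≫ ComonObj.comul
  lax_copy : ∀ {X Y : B} (R : X ⟶ Y), R ≫ ComonObj.comul ≤ ComonObj.comul ≫ (R ⊗ₘ R)
  lax_discard : ∀ {X Y : B} (R : X ⟶ Y), R ≫ ComonObj.counit ≤ (ComonObj.counit : X ⟶ 𝟙_ B)
  copy_tensor : ∀ X Y : B, (ComonObj.comul : X ⊗ Y ⟶ (X ⊗ Y) ⊗ (X ⊗ Y)) =
    (ComonObj.comul ⊗ₘ ComonObj.comul) ≫ tensorμ X X Y Y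
  discard_tensor : ∀ X Y : B, (ComonObj.counit : X ⊗ Y ⟶ 𝟙_ B) =
    (ComonObj.counit ⊗ₘ ComonObj.counit) ≫ (λ_ (𝟙_ B)).hom
  copy_unit : (ComonObj.comul : 𝟙_ B ⟶ 𝟙_ B ⊗ 𝟙_ B) = (λ_ (𝟙_ B)).inv
  discard_unit : (ComonObj.counit : 𝟙_ B ⟶ 𝟙_ B) = 𝟙 (𝟙_ B)

attribute [reducible] CartesianBicategory.homOrder CartesianBicategory.comon

attribute [instance] CartesianBicategory.homOrder CartesianBicategory.comon
  CartesianBicategory.comm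

/-- Bundled cartesian bicategories. -/
structure CartBicat where
  carrier : Type u
  [category : Category.{v} carrier]
  [monoidal : MonoidalCategory carrier]
  [symmetric : SymmetricCategory carrier]
  [cartesianBicategory : CartesianBicategory carrier]

namespace CartBicat

attribute [instance] category monoidal symmetric cartesianBicategory

/-- A morphism of cartesian bicategories: a (strong, symmetric) monoidal functor preserving the
ordering and the chosen monoids and comonoids. -/
structure Hom (A B : CartBicat.{v, u}) where
  functor : A.carrier ⥤ B.carrier
  [braided : functor.Braided]
  map_mono : ∀ {X Y : A.carrier} {f g : X ⟶ Y}, f ≤ g → functor.map f ≤ functor.map g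
  map_copy : ∀ X : A.carrier, functor.map (ComonObj.comul : X ⟶ X ⊗ X) =
    ComonObj.comul ≫ Functor.LaxMonoidal.μ functor X X
  map_discard : ∀ X : A.carrier, functor.map (ComonObj.counit : X ⟶ 𝟙_ A.carrier) =
    ComonObj.counit ≫ Functor.LaxMonoidal.ε functor
  map_cocopy : ∀ X : A.carrier,
    Functor.LaxMonoidal.μ functor X X ≫ functor.map (CartesianBicategory.cocopy X) =
      CartesianBicategory.cocopy (functor.obj X)
  map_codiscard : ∀ X : A.carrier,
    Functor.LaxMonoidal.ε functor ≫ functor.map (CartesianBicategory.codiscard X) =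
      CartesianBicategory.codiscard (functor.obj X)

attribute [instance] Hom.braided

/-- Morphisms agree when their functors and the structure morphisms `ε`, `μ` agree. -/
theorem Hom.ext_of {A B : CartBicat.{v, u}} {F G : A.carrier ⥤ B.carrier} (h : F = G)
    [iF : F.Braided] [iG : G.Braided] {p₁ p₂ p₃ p₄ p₅ q₁ q₂ q₃ q₄ q₅}
    (hε : HEq (Functor.LaxMonoidal.ε F) (Functor.LaxMonoidal.ε G))
    (hμ : HEq (Functor.LaxMonoidal.μ F) (Functor.LaxMonoidal.μ G)) :
    (Hom.mk F p₁ p₂ p₃ p₄ p₅ : Hom A B) = Hom.mk G q₁ q₂ q₃ q₄ q₅ := by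
  subst h
  have : iF = iG := by
    apply Functor.Braided.toMonoidal_injective
    apply Functor.Monoidal.toLaxMonoidal_injective
    exact Functor.LaxMonoidal.ext (eq_of_heq hε) (eq_of_heq hμ)
  subst this
  rfl

def Hom.id (A : CartBicat.{v, u}) : Hom A A where
  functor := 𝟭 A.carrier
  map_mono h := h
  map_copy X := by simp
  map_discard X := by simp
  map_cocopy X := by simp
  map_codiscard X := by simp

def Hom.comp {A B D : CartBicat.{v, u}} (F : Hom A B) (G : Hom B D) : Hom A D where
  functor := F.functor ⋙ G.functor
  map_mono h := G.map_mono (F.map_mono h)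
  map_copy X := by simp [F.map_copy, G.map_copy]
  map_discard X := by simp [F.map_discard, G.map_discard]
  map_cocopy X := by simp [← Functor.map_comp, F.map_cocopy, G.map_cocopy]
  map_codiscard X := by simp [← Functor.map_comp, F.map_codiscard, G.map_codiscard]

instance : Category CartBicat.{v, u} where
  Hom := Hom
  id := Hom.id
  comp := Hom.comp
  id_comp F := by
    refine Hom.ext_of (Functor.id_comp _) (heq_of_eq ?_) (heq_of_eq ?_)
    · exact (Functor.LaxMonoidal.comp_ε (𝟭 _) F.functor).trans (by simp)
    · funext X Y
      exact (Functor.LaxMonoidal.comp_μ (𝟭 _) F.functor X Y).trans (by simp)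
  comp_id F := by
    refine Hom.ext_of (Functor.comp_id _) (heq_of_eq ?_) (heq_of_eq ?_)
    · exact (Functor.LaxMonoidal.comp_ε F.functor (𝟭 _)).trans (by simp)
    · funext X Y
      exact (Functor.LaxMonoidal.comp_μ F.functor (𝟭 _) X Y).trans (by simp)
  assoc F G H := by
    refine Hom.ext_of (Functor.assoc _ _ _) (heq_of_eq ?_) (heq_of_eq ?_)
    · exact (Functor.LaxMonoidal.comp_ε (F.functor ⋙ G.functor) H.functor).trans
        (Eq.trans (by simp) (Functor.LaxMonoidal.comp_ε F.functor (G.functor ⋙ H.functor)).symm)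
    · funext X Y
      exact (Functor.LaxMonoidal.comp_μ (F.functor ⋙ G.functor) H.functor X Y).trans
        (Eq.trans (by simp) (Functor.LaxMonoidal.comp_μ F.functor (G.functor ⋙ H.functor) X Y).symm)

end CartBicat

/-! ### Systems of covers -/

section Covers

variable {C : Type u} [Category.{v} C] [CartesianMonoidalCategory C]

/-- A system of covers on a category with finite products (binary products `⊗` and terminal object
`𝟙_ C`) and weak pullbacks. -/
structure IsSystemOfCovers (S : MorphismProperty C) : Prop where
  id_mem : ∀ X : C, S (𝟙 X)
  comp_mem : ∀ {X Y Z : C} (f : X ⟶ Y) (g : Y ⟶ Z), S f → S g → S (f ≫ g)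
  prod_mem : ∀ {X Y Z W : C} (f : X ⟶ Y) (g : Z ⟶ W), S f → S g → S (f ⊗ₘ g)
  weakPullback_mem : ∀ {X Y Z : C} {f : X ⟶ Z} {g : Y ⟶ Z} (c : PullbackCone f g)
    (_ : IsWeakLimit c), S g → S c.fst
  of_comp_mem : ∀ {X Y Z : C} (f : X ⟶ Y) (g : Y ⟶ Z), S (f ≫ g) → S g

end Covers

/-- The class of split epimorphisms. -/
def splitEpis (C : Type u) [Category.{v} C] : MorphismProperty C :=
  fun _ _ f => IsSplitEpi f

/-! ### Spans -/

/-- Spans `X ⟵ A ⟶ Y`, without any condition on the legs. -/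
abbrev PlainSpan {C : Type u} [Category.{v} C] (X Y : C) : Type (max u v) :=
  Span (⊤ : MorphismProperty C) (⊤ : MorphismProperty C) X Y

namespace PlainSpan

variable {C : Type u} [Category.{v} C]

/-- The span with given legs. -/
abbrev mk {X Y A : C} (l : A ⟶ X) (r : A ⟶ Y) : PlainSpan X Y :=
  ⟨A, l, r, trivial, trivial⟩

/-- Composition of spans through a chosen weak pullback. -/
noncomputable def comp [HasWeakPullbacks C] {X Y Z : C} (s : PlainSpan X Y) (t : PlainSpan Y Z) :
    PlainSpan X Z :=
  mk (weakPullback.fst s.r t.l ≫ s.l) (weakPullback.snd s.r t.l ≫ t.r)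

/-- Product of spans. -/
def prod [CartesianMonoidalCategory C] {X Y Z W : C} (s : PlainSpan X Y) (t : PlainSpan Z W) :
    PlainSpan (X ⊗ Z) (Y ⊗ W) :=
  mk (s.l ⊗ₘ t.l) (s.r ⊗ₘ t.r)

/-- The span `X = X ⟶ Y` of a morphism. -/
def graph {X Y : C} (f : X ⟶ Y) : PlainSpan X Y := mk (𝟙 X) f

/-- The span `Y ⟵ X = X` of a morphism. -/
def cograph {X Y : C} (f : X ⟶ Y) : PlainSpan Y X := mk f (𝟙 X)

/-- The relation on generalised elements induced by a span. -/
def Rel {X Y : C} (s : PlainSpan X Y) {T : C} (x : T ⟶ X) (y : T ⟶ Y) : Prop :=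
  ∃ a : T ⟶ s.apex, a ≫ s.l = x ∧ a ≫ s.r = y

theorem nonempty_hom_of_rel {X Y : C} {s t : PlainSpan X Y}
    (h : ∀ (T : C) (x : T ⟶ X) (y : T ⟶ Y), s.Rel x y → t.Rel x y) :
    Nonempty (Span.Hom s t) := by
  obtain ⟨a, h₁, h₂⟩ := h s.apex s.l s.r ⟨𝟙 _, by simp, by simp⟩
  exact ⟨⟨a, h₁, h₂⟩⟩

theorem rel_mk {X Y A : C} (l : A ⟶ X) (r : A ⟶ Y) {T : C} (x : T ⟶ X) (y : T ⟶ Y) :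
    (mk l r).Rel x y ↔ ∃ a : T ⟶ A, a ≫ l = x ∧ a ≫ r = y := Iff.rfl

theorem rel_comp [HasWeakPullbacks C] {X Y Z : C} (s : PlainSpan X Y) (t : PlainSpan Y Z)
    {T : C} (x : T ⟶ X) (z : T ⟶ Z) :
    (s.comp t).Rel x z ↔ ∃ y : T ⟶ Y, s.Rel x y ∧ t.Rel y z := by
  rw [comp, rel_mk]
  constructor
  · rintro ⟨a, rfl, rfl⟩
    exact ⟨a ≫ weakPullback.fst s.r t.l ≫ s.r,
      ⟨a ≫ weakPullback.fst s.r t.l, by rw [Category.assoc], by rw [Category.assoc]⟩,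
      ⟨a ≫ weakPullback.snd s.r t.l, by rw [weakPullback.condition, Category.assoc],
        by rw [Category.assoc]⟩⟩
  · rintro ⟨_, ⟨a, rfl, rfl⟩, ⟨b, h, rfl⟩⟩
    obtain ⟨c, hc, hd⟩ := weakPullback.exists_lift s.r t.l a b h.symm
    exact ⟨c, by rw [reassoc_of% hc], by rw [reassoc_of% hd]⟩

theorem rel_prod [CartesianMonoidalCategory C] {X Y Z W : C} (s : PlainSpan X Y)
    (t : PlainSpan Z W) {T : C} (x : T ⟶ X ⊗ Z) (y : T ⟶ Y ⊗ W) :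
    (s.prod t).Rel x y ↔
      s.Rel (x ≫ fst _ _) (y ≫ fst _ _) ∧ t.Rel (x ≫ snd _ _) (y ≫ snd _ _) := by
  rw [prod, rel_mk]
  constructor
  · rintro ⟨a, rfl, rfl⟩
    exact ⟨⟨a ≫ fst _ _, by simp, by simp⟩, ⟨a ≫ snd _ _, by simp, by simp⟩⟩
  · rintro ⟨⟨a, h₁, h₂⟩, ⟨b, h₃, h₄⟩⟩
    refine ⟨lift a b, ?_, ?_⟩
    · ext <;> simp [*]
    · ext <;> simp [*]

theorem rel_graph {X Y : C} (f : X ⟶ Y) {T : C} (x : T ⟶ X) (y : T ⟶ Y) :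
    (graph f).Rel x y ↔ x ≫ f = y := by
  rw [graph, rel_mk]
  simp

theorem rel_cograph {X Y : C} (f : X ⟶ Y) {T : C} (y : T ⟶ Y) (x : T ⟶ X) :
    (cograph f).Rel y x ↔ x ≫ f = y := by
  rw [cograph, rel_mk]
  simp

end PlainSpan

/-- A preorder on spans that is coarser than the existence of a morphism of spans, and compatible
with composition and products of spans. -/
structure SpanOrder (C : Type u) [Category.{v} C] [CartesianMonoidalCategory C]
    [HasWeakPullbacks C] where
  le : ∀ {X Y : C}, PlainSpan X Y → PlainSpan X Y → Prop
  le_of_hom : ∀ {X Y : C} {s t : PlainSpan X Y}, Nonempty (Span.Hom s t) → le s t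
  le_trans : ∀ {X Y : C} {s t r : PlainSpan X Y}, le s t → le t r → le s r
  le_comp : ∀ {X Y Z : C} {s s₁ : PlainSpan X Y} {t t₁ : PlainSpan Y Z},
    le s s₁ → le t t₁ → le (s.comp t) (s₁.comp t₁)
  le_prod : ∀ {X Y Z W : C} {s s₁ : PlainSpan X Y} {t t₁ : PlainSpan Z W},
    le s s₁ → le t t₁ → le (s.prod t) (s₁.prod t₁)

section Orders

variable (C : Type u) [Category.{v} C] [CartesianMonoidalCategory C] [HasWeakPullbacks C]

/-- `s ≤ t` if there is a morphism of spans from `s` to `t`. -/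
def tildeOrder : SpanOrder C where
  le s t := Nonempty (Span.Hom s t)
  le_of_hom h := h
  le_trans := by
    rintro X Y s t r ⟨f⟩ ⟨g⟩
    exact ⟨⟨f.hom ≫ g.hom, by simp, by simp⟩⟩
  le_comp := by
    rintro X Y Z s s₁ t t₁ ⟨f⟩ ⟨g⟩
    apply PlainSpan.nonempty_hom_of_rel
    intro T x z
    rw [PlainSpan.rel_comp, PlainSpan.rel_comp]
    rintro ⟨y, ⟨a, rfl, rfl⟩, ⟨b, h, rfl⟩⟩
    exact ⟨_, ⟨a ≫ f.hom, by simp, rfl⟩, ⟨b ≫ g.hom, by simp [h], by simp⟩⟩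
  le_prod := by
    rintro X Y Z W s s₁ t t₁ ⟨f⟩ ⟨g⟩
    exact ⟨⟨f.hom ⊗ₘ g.hom, by simp [PlainSpan.prod], by simp [PlainSpan.prod]⟩⟩

variable {C}

/-- `s ≤ t` if there are a cover `π : A ⟶ s.apex` and a morphism `a : A ⟶ t.apex` making
the two triangles over the feet commute. -/
def coverOrder (S : MorphismProperty C) (hS : IsSystemOfCovers S) : SpanOrder C where
  le s t := ∃ (A : C) (π : A ⟶ s.apex) (a : A ⟶ t.apex),
    S π ∧ a ≫ t.l = π ≫ s.l ∧ a ≫ t.r = π ≫ s.r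
  le_of_hom := by
    rintro X Y s t ⟨f⟩
    exact ⟨_, 𝟙 _, f.hom, hS.id_mem _, by simp, by simp⟩
  le_trans := by
    rintro X Y s t r ⟨A, π, a, hπ, h₁, h₂⟩ ⟨B, ρ, b, hρ, h₃, h₄⟩
    have hw := weakPullback.condition (f := a) (g := ρ)
    refine ⟨weakPullback a ρ, weakPullback.fst a ρ ≫ π, weakPullback.snd a ρ ≫ b,
      hS.comp_mem _ _ (hS.weakPullback_mem _ (weakPullback.isWeakLimit a ρ) hρ) hπ, ?_, ?_⟩
    · rw [Category.assoc, Category.assoc, h₃, ← h₁, ← reassoc_of% hw]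
    · rw [Category.assoc, Category.assoc, h₄, ← h₂, ← reassoc_of% hw]
  le_comp := by
    rintro X Y Z s s₁ t t₁ ⟨A, π, a, hπ, h₁, h₂⟩ ⟨B, ρ, b, hρ, h₃, h₄⟩
    let p := weakPullback.fst s.r t.l
    let q := weakPullback.snd s.r t.l
    let p₁ := weakPullback.fst p π
    let q₁ := weakPullback.snd p π
    let p₂ := weakPullback.fst (p₁ ≫ q) ρ
    let q₂ := weakPullback.snd (p₁ ≫ q) ρ
    have hpq : p ≫ s.r = q ≫ t.l := weakPullback.condition
    have hpq₁ : p₁ ≫ p = q₁ ≫ π := weakPullback.condition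
    have hpq₂ : p₂ ≫ p₁ ≫ q = q₂ ≫ ρ := weakPullback.condition
    obtain ⟨c, hc, hd⟩ := weakPullback.exists_lift s₁.r t₁.l (p₂ ≫ q₁ ≫ a) (q₂ ≫ b) (by
      simp only [Category.assoc, h₂, h₃]
      rw [← reassoc_of% hpq₁, ← reassoc_of% hpq₂, hpq])
    refine ⟨_, p₂ ≫ p₁, c,
      hS.comp_mem _ _ (hS.weakPullback_mem _ (weakPullback.isWeakLimit (p₁ ≫ q) ρ) hρ)
        (hS.weakPullback_mem _ (weakPullback.isWeakLimit p π) hπ), ?_, ?_⟩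
    · change c ≫ weakPullback.fst s₁.r t₁.l ≫ s₁.l = (p₂ ≫ p₁) ≫ p ≫ s.l
      rw [reassoc_of% hc, h₁, Category.assoc, reassoc_of% hpq₁]
    · change c ≫ weakPullback.snd s₁.r t₁.l ≫ t₁.r = (p₂ ≫ p₁) ≫ q ≫ t.r
      rw [reassoc_of% hd, h₄, ← reassoc_of% hpq₂, Category.assoc]
  le_prod := by
    rintro X Y Z W s s₁ t t₁ ⟨A, π, a, hπ, h₁, h₂⟩ ⟨B, ρ, b, hρ, h₃, h₄⟩
    refine ⟨_, π ⊗ₘ ρ, a ⊗ₘ b, hS.prod_mem _ _ hπ hρ, ?_, ?_⟩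
    · simp [PlainSpan.prod, h₁, h₃]
    · simp [PlainSpan.prod, h₂, h₄]

end Orders

/-! ### Identities between structure morphisms of finite products -/

section Products

variable {C : Type u} [Category.{v} C] [CartesianMonoidalCategory C]

/-- Equality of morphisms into a product, tested on the two projections. -/
theorem eq_iff_fst_snd {T X Y : C} (f g : T ⟶ X ⊗ Y) :
    f = g ↔ f ≫ fst _ _ = g ≫ fst _ _ ∧ f ≫ snd _ _ = g ≫ snd _ _ :=
  ⟨by rintro rfl; exact ⟨rfl, rfl⟩, fun h => CartesianMonoidalCategory.hom_ext _ _ h.1 h.2⟩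

/-- The symmetry of the cartesian product. -/
def swapIso (X Y : C) : X ⊗ Y ≅ Y ⊗ X where
  hom := lift (snd X Y) (fst X Y)
  inv := lift (snd Y X) (fst Y X)

theorem swap_hexagon_forward (X Y Z : C) :
    (α_ X Y Z).hom ≫ (swapIso X (Y ⊗ Z)).hom ≫ (α_ Y Z X).hom =
      ((swapIso X Y).hom ▷ Z) ≫ (α_ Y X Z).hom ≫ (Y ◁ (swapIso X Z).hom) := by
  simp only [eq_iff_fst_snd]
  simp [swapIso]

theorem swap_hexagon_reverse (X Y Z : C) :
    (α_ X Y Z).inv ≫ (swapIso (X ⊗ Y) Z).hom ≫ (α_ Z X Y).inv =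
      (X ◁ (swapIso Y Z).hom) ≫ (α_ X Z Y).inv ≫ ((swapIso X Z).hom ▷ Y) := by
  simp only [eq_iff_fst_snd]
  simp [swapIso]

theorem diag_counit_left (X : C) : lift (𝟙 X) (𝟙 X) ≫ toUnit X ▷ X = (λ_ X).inv := by
  rw [eq_iff_fst_snd]
  exact ⟨toUnit_unique _ _, by simp⟩

theorem diag_counit_right (X : C) : lift (𝟙 X) (𝟙 X) ≫ X ◁ toUnit X = (ρ_ X).inv := by
  rw [eq_iff_fst_snd]
  exact ⟨by simp, toUnit_unique _ _⟩

theorem diag_assoc (X : C) : lift (𝟙 X) (𝟙 X) ≫ X ◁ lift (𝟙 X) (𝟙 X) =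
    lift (𝟙 X) (𝟙 X) ≫ lift (𝟙 X) (𝟙 X) ▷ X ≫ (α_ X X X).hom := by
  simp only [eq_iff_fst_snd]
  simp

theorem diag_swap (X : C) :
    lift (𝟙 X) (𝟙 X) ≫ (swapIso X X).hom = lift (𝟙 X) (𝟙 X) := by
  simp only [eq_iff_fst_snd]
  simp [swapIso]

theorem swap_middle (X Y Z W : C) :
    (α_ X Y (Z ⊗ W)).hom ≫ (X ◁ (α_ Y Z W).inv) ≫ (X ◁ ((swapIso Y Z).hom ▷ W)) ≫
      (X ◁ (α_ Z Y W).hom) ≫ (α_ X Z (Y ⊗ W)).inv =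
    lift (fst X Y ⊗ₘ fst Z W) (snd X Y ⊗ₘ snd Z W) := by
  simp only [eq_iff_fst_snd]
  simp [swapIso]

theorem diag_tensor (X Y : C) : lift (𝟙 (X ⊗ Y)) (𝟙 (X ⊗ Y)) =
    (lift (𝟙 X) (𝟙 X) ⊗ₘ lift (𝟙 Y) (𝟙 Y)) ≫
      lift (fst X X ⊗ₘ fst Y Y) (snd X X ⊗ₘ snd Y Y) := by
  simp only [eq_iff_fst_snd]
  simp

theorem diag_unit : lift (𝟙 (𝟙_ C)) (𝟙 (𝟙_ C)) = (λ_ (𝟙_ C)).inv := by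
  rw [eq_iff_fst_snd]
  exact ⟨toUnit_unique _ _, toUnit_unique _ _⟩

end Products

/-! ### The cartesian bicategory of spans modulo the equivalence relation of a span order -/

/-- The category with the objects of `C`, whose morphisms are spans modulo the equivalence relation
`s ≤ t ∧ t ≤ s` of the order `O`. -/
@[ext]
structure SpanCat {C : Type u} [Category.{v} C] [CartesianMonoidalCategory C]
    [HasWeakPullbacks C] (O : SpanOrder C) where
  of : C

namespace SpanCat

variable {C : Type u} [Category.{v} C] [CartesianMonoidalCategory C] [HasWeakPullbacks C]
  (O : SpanOrder C)

/-- Equivalence of spans with respect to `O`. -/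
def setoid (X Y : C) : Setoid (PlainSpan X Y) where
  r s t := O.le s t ∧ O.le t s
  iseqv :=
    { refl := fun s => ⟨O.le_of_hom ⟨⟨𝟙 _, by simp, by simp⟩⟩, O.le_of_hom ⟨⟨𝟙 _, by simp, by simp⟩⟩⟩
      symm := fun h => ⟨h.2, h.1⟩
      trans := fun h k => ⟨O.le_trans h.1 k.1, O.le_trans k.2 h.2⟩ }

/-- Equivalence classes of spans. -/
def SpanClass (X Y : C) : Type (max u v) := Quotient (setoid O X Y)

variable {O}

namespace SpanClass

/-- The class of a span. -/
def mk {X Y : C} (s : PlainSpan X Y) : SpanClass O X Y := Quotient.mk (setoid O X Y) s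

noncomputable def comp {X Y Z : C} (f : SpanClass O X Y) (g : SpanClass O Y Z) :
    SpanClass O X Z :=
  Quotient.map₂ PlainSpan.comp
    (fun _ _ (h : O.le _ _ ∧ O.le _ _) _ _ (k : O.le _ _ ∧ O.le _ _) =>
      ⟨O.le_comp h.1 k.1, O.le_comp h.2 k.2⟩) f g

def prod {X Y Z W : C} (f : SpanClass O X Y) (g : SpanClass O Z W) :
    SpanClass O (X ⊗ Z) (Y ⊗ W) :=
  Quotient.map₂ PlainSpan.prod
    (fun _ _ (h : O.le _ _ ∧ O.le _ _) _ _ (k : O.le _ _ ∧ O.le _ _) =>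
      ⟨O.le_prod h.1 k.1, O.le_prod h.2 k.2⟩) f g

instance (X Y : C) : PartialOrder (SpanClass O X Y) where
  le := Quotient.lift₂ O.le (fun _ _ _ _ h k => propext
    ⟨fun l => O.le_trans h.2 (O.le_trans l k.1), fun l => O.le_trans h.1 (O.le_trans l k.2)⟩)
  le_refl := by
    rintro ⟨s⟩
    exact O.le_of_hom ⟨⟨𝟙 _, by simp, by simp⟩⟩
  le_trans := by
    rintro ⟨s⟩ ⟨t⟩ ⟨r⟩ h k
    exact O.le_trans (s := s) (t := t) (r := r) h k
  le_antisymm := by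
    rintro ⟨s⟩ ⟨t⟩ h k
    exact Quotient.sound ⟨h, k⟩

theorem mk_le_mk {X Y : C} {s t : PlainSpan X Y} :
    (mk s : SpanClass O X Y) ≤ mk t ↔ O.le s t := Iff.rfl

theorem mk_surj {X Y : C} (f : SpanClass O X Y) : ∃ s, f = mk s := by
  obtain ⟨s, rfl⟩ := Quotient.exists_rep f
  exact ⟨s, rfl⟩

theorem le_of_rel {X Y : C} {s t : PlainSpan X Y}
    (h : ∀ (T : C) (x : T ⟶ X) (y : T ⟶ Y), s.Rel x y → t.Rel x y) :
    (mk s : SpanClass O X Y) ≤ mk t :=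
  O.le_of_hom (PlainSpan.nonempty_hom_of_rel h)

theorem eq_of_rel {X Y : C} {s t : PlainSpan X Y}
    (h : ∀ (T : C) (x : T ⟶ X) (y : T ⟶ Y), s.Rel x y ↔ t.Rel x y) :
    (mk s : SpanClass O X Y) = mk t :=
  le_antisymm (le_of_rel fun T x y => (h T x y).1) (le_of_rel fun T x y => (h T x y).2)

/-- Any weak pullback computes the composite. -/
theorem comp_eq_of_isWeakLimit {X Y Z : C} (s : PlainSpan X Y) (t : PlainSpan Y Z)
    (c : PullbackCone s.r t.l) (hc : IsWeakLimit c) :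
    comp (mk s) (mk t) =
      (mk (PlainSpan.mk (c.fst ≫ s.l) (c.snd ≫ t.r)) : SpanClass O X Z) := by
  refine eq_of_rel (s := s.comp t) fun T x z => ?_
  rw [PlainSpan.rel_comp]
  constructor
  · rintro ⟨_, ⟨a, rfl, rfl⟩, ⟨b, h, rfl⟩⟩
    exact ⟨PullbackCone.IsWeakLimit.lift hc a b h.symm, by simp [← Category.assoc],
      by simp [← Category.assoc]⟩
  · rintro ⟨a, rfl, rfl⟩
    exact ⟨a ≫ c.fst ≫ s.r, ⟨a ≫ c.fst, by simp, by simp⟩,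
      ⟨a ≫ c.snd, by simp [c.condition], by simp⟩⟩

end SpanClass

noncomputable instance : Category (SpanCat O) where
  Hom X Y := SpanClass O X.of Y.of
  id X := SpanClass.mk (PlainSpan.graph (𝟙 X.of))
  comp := SpanClass.comp
  id_comp := by
    rintro X Y ⟨s⟩
    refine SpanClass.eq_of_rel (s := PlainSpan.comp _ s) fun T x y => ?_
    simp [PlainSpan.rel_comp, PlainSpan.rel_graph]
  comp_id := by
    rintro X Y ⟨s⟩
    refine SpanClass.eq_of_rel (s := PlainSpan.comp s _) fun T x y => ?_
    simp [PlainSpan.rel_comp, PlainSpan.rel_graph]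
  assoc := by
    rintro X Y Z W ⟨s⟩ ⟨t⟩ ⟨r⟩
    refine SpanClass.eq_of_rel (s := (s.comp t).comp r) (t := s.comp (t.comp r)) fun T x y => ?_
    simp only [PlainSpan.rel_comp]
    grind

instance (X Y : SpanCat O) : PartialOrder (X ⟶ Y) :=
  inferInstanceAs (PartialOrder (SpanClass O X.of Y.of))

/-- The morphism represented by a span. -/
def cls {X Y : SpanCat O} (s : PlainSpan X.of Y.of) : X ⟶ Y := SpanClass.mk s

theorem cls_comp_cls {X Y Z : SpanCat O} (s : PlainSpan X.of Y.of) (t : PlainSpan Y.of Z.of) :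
    (cls s : X ⟶ Y) ≫ (cls t : Y ⟶ Z) = cls (s.comp t) := rfl

theorem id_eq_cls (X : SpanCat O) : 𝟙 X = cls (PlainSpan.graph (𝟙 X.of)) := rfl

theorem cls_surj {X Y : SpanCat O} (f : X ⟶ Y) : ∃ s, f = cls s := SpanClass.mk_surj f

theorem cls_le_of_rel {X Y : SpanCat O} {s t : PlainSpan X.of Y.of}
    (h : ∀ (T : C) (x : T ⟶ X.of) (y : T ⟶ Y.of), s.Rel x y → t.Rel x y) :
    (cls s : X ⟶ Y) ≤ cls t := SpanClass.le_of_rel h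

theorem cls_eq_of_rel {X Y : SpanCat O} {s t : PlainSpan X.of Y.of}
    (h : ∀ (T : C) (x : T ⟶ X.of) (y : T ⟶ Y.of), s.Rel x y ↔ t.Rel x y) :
    (cls s : X ⟶ Y) = cls t := SpanClass.eq_of_rel h

/-- An isomorphism of `C` gives an isomorphism of span classes. -/
noncomputable def graphIso {X Y : SpanCat O} (e : X.of ≅ Y.of) : X ≅ Y where
  hom := cls (PlainSpan.graph e.hom)
  inv := cls (PlainSpan.graph e.inv)
  hom_inv_id := by
    rw [cls_comp_cls, id_eq_cls]
    exact cls_eq_of_rel fun T x y => by simp [PlainSpan.rel_comp, PlainSpan.rel_graph]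
  inv_hom_id := by
    rw [cls_comp_cls, id_eq_cls]
    exact cls_eq_of_rel fun T x y => by simp [PlainSpan.rel_comp, PlainSpan.rel_graph]

noncomputable instance : MonoidalCategoryStruct (SpanCat O) where
  tensorObj X Y := ⟨X.of ⊗ Y.of⟩
  tensorHom f g := SpanClass.prod f g
  whiskerLeft X _ _ f := SpanClass.prod (SpanClass.mk (PlainSpan.graph (𝟙 X.of))) f
  whiskerRight f Y := SpanClass.prod f (SpanClass.mk (PlainSpan.graph (𝟙 Y.of)))
  tensorUnit := ⟨𝟙_ C⟩
  associator X Y Z := graphIso (X := ⟨(X.of ⊗ Y.of) ⊗ Z.of⟩) (Y := ⟨X.of ⊗ Y.of ⊗ Z.of⟩)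
    (α_ X.of Y.of Z.of)
  leftUnitor X := graphIso (X := ⟨𝟙_ C ⊗ X.of⟩) (λ_ X.of)
  rightUnitor X := graphIso (X := ⟨X.of ⊗ 𝟙_ C⟩) (ρ_ X.of)

theorem cls_tensor_cls {X Y Z W : SpanCat O} (s : PlainSpan X.of Y.of) (t : PlainSpan Z.of W.of) :
    (cls s : X ⟶ Y) ⊗ₘ (cls t : Z ⟶ W) = cls (s.prod t) := rfl

theorem whiskerLeft_cls (X : SpanCat O) {Z W : SpanCat O} (t : PlainSpan Z.of W.of) :
    X ◁ (cls t : Z ⟶ W) = cls ((PlainSpan.graph (𝟙 X.of)).prod t) := rfl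

theorem cls_whiskerRight {X Y : SpanCat O} (s : PlainSpan X.of Y.of) (Z : SpanCat O) :
    (cls s : X ⟶ Y) ▷ Z = cls (s.prod (PlainSpan.graph (𝟙 Z.of))) := rfl

theorem associator_hom (X Y Z : SpanCat O) :
    (α_ X Y Z).hom = cls (PlainSpan.graph (α_ X.of Y.of Z.of).hom) := rfl

theorem associator_inv (X Y Z : SpanCat O) :
    (α_ X Y Z).inv = cls (PlainSpan.graph (α_ X.of Y.of Z.of).inv) := rfl

theorem leftUnitor_hom (X : SpanCat O) :
    (λ_ X).hom = cls (PlainSpan.graph (λ_ X.of).hom) := rfl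

theorem leftUnitor_inv (X : SpanCat O) :
    (λ_ X).inv = cls (PlainSpan.graph (λ_ X.of).inv) := rfl

theorem rightUnitor_hom (X : SpanCat O) :
    (ρ_ X).hom = cls (PlainSpan.graph (ρ_ X.of).hom) := rfl

theorem rightUnitor_inv (X : SpanCat O) :
    (ρ_ X).inv = cls (PlainSpan.graph (ρ_ X.of).inv) := rfl

theorem graph_comp {X Y Z : SpanCat O} (f : X.of ⟶ Y.of) (g : Y.of ⟶ Z.of) :
    (cls (PlainSpan.graph f) : X ⟶ Y) ≫ (cls (PlainSpan.graph g) : Y ⟶ Z) =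
      cls (PlainSpan.graph (f ≫ g)) :=
  cls_eq_of_rel fun T x y => by simp [PlainSpan.rel_comp, PlainSpan.rel_graph]

theorem graph_tensor {X Y Z W : SpanCat O} (f : X.of ⟶ Y.of) (g : Z.of ⟶ W.of) :
    (cls (PlainSpan.graph f) : X ⟶ Y) ⊗ₘ (cls (PlainSpan.graph g) : Z ⟶ W) =
      cls (PlainSpan.graph (f ⊗ₘ g)) :=
  cls_eq_of_rel (s := PlainSpan.prod _ _) (t := PlainSpan.graph _) fun T x y => by
    simp [PlainSpan.rel_prod, PlainSpan.rel_graph, eq_iff_fst_snd]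

theorem graph_whiskerLeft (X : SpanCat O) {Z W : SpanCat O} (g : Z.of ⟶ W.of) :
    X ◁ (cls (PlainSpan.graph g) : Z ⟶ W) = cls (PlainSpan.graph (X.of ◁ g)) :=
  cls_eq_of_rel (s := PlainSpan.prod _ _) (t := PlainSpan.graph _) fun T x y => by
    simp [PlainSpan.rel_prod, PlainSpan.rel_graph, eq_iff_fst_snd]

theorem graph_whiskerRight {X Y : SpanCat O} (f : X.of ⟶ Y.of) (Z : SpanCat O) :
    (cls (PlainSpan.graph f) : X ⟶ Y) ▷ Z = cls (PlainSpan.graph (f ▷ Z.of)) :=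
  cls_eq_of_rel (s := PlainSpan.prod _ _) (t := PlainSpan.graph _) fun T x y => by
    simp [PlainSpan.rel_prod, PlainSpan.rel_graph, eq_iff_fst_snd]

noncomputable instance : MonoidalCategory (SpanCat O) :=
  MonoidalCategory.ofTensorHom
    (id_tensorHom_id := fun X Y => by
      rw [id_eq_cls, id_eq_cls, id_eq_cls, graph_tensor, id_tensorHom_id]; rfl)
    (id_tensorHom := fun X Y Z f => rfl)
    (tensorHom_id := fun f Y => rfl)
    (tensorHom_comp_tensorHom := fun f₁ f₂ g₁ g₂ => by
      obtain ⟨f₁, rfl⟩ := cls_surj f₁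
      obtain ⟨f₂, rfl⟩ := cls_surj f₂
      obtain ⟨g₁, rfl⟩ := cls_surj g₁
      obtain ⟨g₂, rfl⟩ := cls_surj g₂
      refine cls_eq_of_rel (s := (f₁.prod f₂).comp (g₁.prod g₂))
        (t := (f₁.comp g₁).prod (f₂.comp g₂)) fun T x y => ?_
      simp only [PlainSpan.rel_comp, PlainSpan.rel_prod]
      constructor
      · rintro ⟨z, ⟨h₁, h₂⟩, h₃, h₄⟩
        exact ⟨⟨_, h₁, h₃⟩, ⟨_, h₂, h₄⟩⟩
      · rintro ⟨⟨a, h₁, h₃⟩, ⟨b, h₂, h₄⟩⟩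
        exact ⟨lift a b, by simp [*], by simp [*]⟩)
    (associator_naturality := fun f₁ f₂ f₃ => by
      obtain ⟨f₁, rfl⟩ := cls_surj f₁
      obtain ⟨f₂, rfl⟩ := cls_surj f₂
      obtain ⟨f₃, rfl⟩ := cls_surj f₃
      refine cls_eq_of_rel (s := ((f₁.prod f₂).prod f₃).comp (PlainSpan.graph (α_ _ _ _).hom))
        (t := (PlainSpan.graph (α_ _ _ _).hom).comp (f₁.prod (f₂.prod f₃))) fun T x y => ?_
      simp only [PlainSpan.rel_comp, PlainSpan.rel_prod, PlainSpan.rel_graph, exists_eq_left']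
      constructor
      · rintro ⟨z, h, rfl⟩
        simpa [and_assoc] using h
      · intro h
        exact ⟨y ≫ (α_ _ _ _).inv, by simpa [and_assoc] using h, by simp⟩)
    (leftUnitor_naturality := fun f => by
      obtain ⟨f, rfl⟩ := cls_surj f
      refine cls_eq_of_rel (s := ((PlainSpan.graph (𝟙 _)).prod f).comp
        (PlainSpan.graph (λ_ _).hom)) (t := (PlainSpan.graph (λ_ _).hom).comp f) fun T x y => ?_
      simp only [PlainSpan.rel_comp, PlainSpan.rel_prod, PlainSpan.rel_graph, exists_eq_left']
      constructor
      · rintro ⟨z, h, rfl⟩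
        simpa [CartesianMonoidalCategory.leftUnitor_hom] using h.2
      · intro h
        exact ⟨y ≫ (λ_ _).inv, ⟨toUnit_unique _ _,
          by simpa [CartesianMonoidalCategory.leftUnitor_hom] using h⟩, by simp⟩)
    (rightUnitor_naturality := fun f => by
      obtain ⟨f, rfl⟩ := cls_surj f
      refine cls_eq_of_rel (s := (f.prod (PlainSpan.graph (𝟙 _))).comp
        (PlainSpan.graph (ρ_ _).hom)) (t := (PlainSpan.graph (ρ_ _).hom).comp f) fun T x y => ?_
      simp only [PlainSpan.rel_comp, PlainSpan.rel_prod, PlainSpan.rel_graph, exists_eq_left']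
      constructor
      · rintro ⟨z, h, rfl⟩
        simpa [CartesianMonoidalCategory.rightUnitor_hom] using h.1
      · intro h
        exact ⟨y ≫ (ρ_ _).inv,
          ⟨by simpa [CartesianMonoidalCategory.rightUnitor_hom] using h,
            toUnit_unique _ _⟩, by simp⟩)
    (pentagon := fun W X Y Z => by
      simp only [associator_hom, id_eq_cls]
      erw [graph_tensor, graph_tensor, graph_comp, graph_comp, graph_comp]
      congr 2
      simp only [tensorHom_id, id_tensorHom]
      exact MonoidalCategory.pentagon W.of X.of Y.of Z.of)
    (triangle := fun X Y => by
      simp only [associator_hom, leftUnitor_hom, rightUnitor_hom, id_eq_cls]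
      erw [graph_tensor, graph_tensor, graph_comp]
      congr 2
      simp only [tensorHom_id, id_tensorHom]
      exact MonoidalCategory.triangle X.of Y.of)

noncomputable instance : SymmetricCategory (SpanCat O) where
  braiding X Y := graphIso (X := X ⊗ Y) (Y := Y ⊗ X) (swapIso X.of Y.of)
  braiding_naturality_right X Y Z f := by
    obtain ⟨f, rfl⟩ := cls_surj f
    refine cls_eq_of_rel (s := ((PlainSpan.graph (𝟙 _)).prod f).comp
      (PlainSpan.graph (swapIso _ _).hom)) (t := (PlainSpan.graph (swapIso _ _).hom).comp
      (f.prod (PlainSpan.graph (𝟙 _)))) fun T x y => ?_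
    simp only [PlainSpan.rel_comp, PlainSpan.rel_prod, PlainSpan.rel_graph, exists_eq_left']
    constructor
    · rintro ⟨z, h, rfl⟩
      simpa [swapIso, and_comm] using h
    · intro h
      exact ⟨y ≫ (swapIso _ _).inv, by simpa [swapIso, and_comm] using h, by simp⟩
  braiding_naturality_left f Z := by
    obtain ⟨f, rfl⟩ := cls_surj f
    refine cls_eq_of_rel (s := (f.prod (PlainSpan.graph (𝟙 _))).comp
      (PlainSpan.graph (swapIso _ _).hom)) (t := (PlainSpan.graph (swapIso _ _).hom).comp
      ((PlainSpan.graph (𝟙 _)).prod f)) fun T x y => ?_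
    simp only [PlainSpan.rel_comp, PlainSpan.rel_prod, PlainSpan.rel_graph, exists_eq_left']
    constructor
    · rintro ⟨z, h, rfl⟩
      simpa [swapIso, and_comm] using h
    · intro h
      exact ⟨y ≫ (swapIso _ _).inv, by simpa [swapIso, and_comm] using h, by simp⟩
  hexagon_forward X Y Z := by
    simp only [associator_hom, graphIso]
    erw [graph_whiskerRight, graph_whiskerLeft, graph_comp, graph_comp, graph_comp, graph_comp]
    congr 2
    exact swap_hexagon_forward X.of Y.of Z.of
  hexagon_reverse X Y Z := by
    simp only [associator_inv, graphIso]
    erw [graph_whiskerRight, graph_whiskerLeft, graph_comp, graph_comp, graph_comp, graph_comp]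
    congr 2
    exact swap_hexagon_reverse X.of Y.of Z.of
  symmetry X Y := by
    simp only [graphIso]
    erw [graph_comp]
    rw [id_eq_cls]
    congr 2
    exact (swapIso _ _).hom_inv_id

theorem braiding_hom (X Y : SpanCat O) :
    (β_ X Y).hom = cls (PlainSpan.graph (swapIso X.of Y.of).hom) := rfl

noncomputable instance (X : SpanCat O) : ComonObj X where
  counit := cls (PlainSpan.graph (toUnit X.of))
  comul := cls (PlainSpan.graph (lift (𝟙 X.of) (𝟙 X.of)))
  counit_comul := by
    rw [leftUnitor_inv]
    erw [graph_whiskerRight, graph_comp]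
    congr 2
    exact diag_counit_left X.of
  comul_counit := by
    rw [rightUnitor_inv]
    erw [graph_whiskerLeft, graph_comp]
    congr 2
    exact diag_counit_right X.of
  comul_assoc := by
    rw [associator_hom]
    erw [graph_whiskerLeft, graph_whiskerRight, graph_comp, graph_comp, graph_comp]
    congr 2
    exact diag_assoc X.of

theorem counit_eq (X : SpanCat O) :
    (ComonObj.counit : X ⟶ 𝟙_ (SpanCat O)) = cls (PlainSpan.graph (toUnit X.of)) := rfl

theorem comul_eq (X : SpanCat O) :
    (ComonObj.comul : X ⟶ X ⊗ X) = cls (PlainSpan.graph (lift (𝟙 X.of) (𝟙 X.of))) := rfl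

instance (X : SpanCat O) : IsCommComonObj X where
  comul_comm := by
    rw [braiding_hom, comul_eq]
    erw [graph_comp]
    congr 2
    exact diag_swap X.of

theorem tensorμ_eq (X Y Z W : SpanCat O) : tensorμ X Y Z W =
    cls (PlainSpan.graph (lift (fst X.of Y.of ⊗ₘ fst Z.of W.of) (snd X.of Y.of ⊗ₘ snd Z.of W.of))) := by
  rw [tensorμ, associator_hom, associator_inv, associator_hom, associator_inv, braiding_hom]
  erw [graph_whiskerLeft, graph_whiskerRight, graph_whiskerLeft, graph_whiskerLeft, graph_comp,
    graph_comp, graph_comp, graph_comp]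
  congr 2
  exact swap_middle X.of Y.of Z.of W.of

noncomputable instance : CartesianBicategory (SpanCat O) where
  comp_mono {X Y Z f f₁ g g₁} := by
    obtain ⟨f, rfl⟩ := cls_surj f
    obtain ⟨f₁, rfl⟩ := cls_surj f₁
    obtain ⟨g, rfl⟩ := cls_surj g
    obtain ⟨g₁, rfl⟩ := cls_surj g₁
    exact O.le_comp
  tensor_mono {X Y Z W f f₁ g g₁} := by
    obtain ⟨f, rfl⟩ := cls_surj f
    obtain ⟨f₁, rfl⟩ := cls_surj f₁
    obtain ⟨g, rfl⟩ := cls_surj g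
    obtain ⟨g₁, rfl⟩ := cls_surj g₁
    exact O.le_prod
  cocopy X := cls (X := X ⊗ X) (PlainSpan.cograph (lift (𝟙 X.of) (𝟙 X.of)))
  codiscard X := cls (X := 𝟙_ (SpanCat O)) (PlainSpan.cograph (toUnit X.of))
  unit_copy X := by
    refine cls_le_of_rel (t := (PlainSpan.graph _).comp (PlainSpan.cograph _)) fun T x y => ?_
    simp [PlainSpan.rel_comp, PlainSpan.rel_graph, PlainSpan.rel_cograph]
    rintro rfl; rfl
  counit_copy X := by
    refine cls_le_of_rel (s := (PlainSpan.cograph _).comp (PlainSpan.graph _)) fun T x y => ?_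
    simp [PlainSpan.rel_comp, PlainSpan.rel_graph, PlainSpan.rel_cograph]
    rintro z rfl rfl; rfl
  unit_discard X := by
    refine cls_le_of_rel (t := (PlainSpan.graph _).comp (PlainSpan.cograph _)) fun T x y => ?_
    simp [PlainSpan.rel_comp, PlainSpan.rel_graph, PlainSpan.rel_cograph]
  counit_discard X := by
    refine cls_le_of_rel (s := (PlainSpan.cograph _).comp (PlainSpan.graph _)) fun T x y => ?_
    simp only [PlainSpan.rel_graph]
    exact fun _ => toUnit_unique _ _
  frobenius_left X := by
    refine cls_eq_of_rel (s := ((PlainSpan.graph (𝟙 _)).prod (PlainSpan.graph _)).comp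
      ((PlainSpan.graph (α_ _ _ _).inv).comp ((PlainSpan.cograph _).prod (PlainSpan.graph (𝟙 _)))))
      (t := (PlainSpan.cograph _).comp (PlainSpan.graph _)) fun T x y => ?_
    simp only [PlainSpan.rel_comp, PlainSpan.rel_prod, PlainSpan.rel_graph,
      PlainSpan.rel_cograph, eq_iff_fst_snd]
    simp
    constructor
    · rintro ⟨a, h, b, k⟩
      grind
    · rintro ⟨⟨h, k⟩, l⟩
      refine ⟨lift (x ≫ fst _ _) (lift (x ≫ snd _ _) (x ≫ snd _ _)), by simp,
        lift (lift (x ≫ fst _ _) (x ≫ snd _ _)) (x ≫ snd _ _), by simp, ?_⟩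
      simp
      grind
  frobenius_right X := by
    refine cls_eq_of_rel (s := ((PlainSpan.graph _).prod (PlainSpan.graph (𝟙 _))).comp
      ((PlainSpan.graph (α_ _ _ _).hom).comp ((PlainSpan.graph (𝟙 _)).prod (PlainSpan.cograph _))))
      (t := (PlainSpan.cograph _).comp (PlainSpan.graph _)) fun T x y => ?_
    simp only [PlainSpan.rel_comp, PlainSpan.rel_prod, PlainSpan.rel_graph,
      PlainSpan.rel_cograph, eq_iff_fst_snd]
    simp
    constructor
    · rintro ⟨a, h, b, k⟩
      grind
    · rintro ⟨⟨h, k⟩, l⟩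
      refine ⟨lift (lift (x ≫ fst _ _) (x ≫ fst _ _)) (x ≫ snd _ _), by simp,
        lift (x ≫ fst _ _) (lift (x ≫ fst _ _) (x ≫ snd _ _)), by simp, ?_⟩
      simp
      grind
  lax_copy {X Y} R := by
    obtain ⟨R, rfl⟩ := cls_surj R
    refine cls_le_of_rel (s := R.comp (PlainSpan.graph _))
      (t := (PlainSpan.graph _).comp (R.prod R)) fun T x y => ?_
    simp only [PlainSpan.rel_comp, PlainSpan.rel_prod, PlainSpan.rel_graph, exists_eq_left']
    rintro ⟨z, h, rfl⟩
    simpa using h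
  lax_discard {X Y} R := by
    obtain ⟨R, rfl⟩ := cls_surj R
    refine cls_le_of_rel (s := R.comp (PlainSpan.graph _)) fun T x y => ?_
    simp only [PlainSpan.rel_graph]
    exact fun _ => toUnit_unique _ _
  copy_tensor X Y := by
    rw [tensorμ_eq, comul_eq, comul_eq, comul_eq]
    erw [graph_tensor, graph_comp]
    congr 2
    exact diag_tensor X.of Y.of
  discard_tensor X Y := by
    rw [counit_eq, counit_eq, counit_eq, leftUnitor_hom]
    erw [graph_tensor, graph_comp]
    congr 2
    exact toUnit_unique _ _
  copy_unit := by
    rw [comul_eq, leftUnitor_inv]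
    congr 2
    exact diag_unit
  discard_unit := by
    rw [counit_eq, id_eq_cls]
    congr 2
    exact toUnit_unique _ _

end SpanCat

section Constructions

variable (C : Type u) [Category.{v} C] [CartesianMonoidalCategory C] [HasWeakPullbacks C]

/-- The cartesian bicategory `Span^~(C)`: spans are ordered by existence of a morphism of spans. -/
noncomputable def SpanTilde : CartBicat.{max u v, u} where
  carrier := SpanCat (tildeOrder C)

variable {C}

/-- The cartesian bicategory `Span^S(C)` of a category with covers `(C, S)`: spans are ordered by
existence of a morphism of spans defined on a cover of the apex. -/
noncomputable def SpanCover (S : MorphismProperty C) (hS : IsSystemOfCovers S) :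
    CartBicat.{max u v, u} where
  carrier := SpanCat (coverOrder S hS)

end Constructions

/-!
A split epimorphism `g` with section `σ` satisfies `σ ≫ g = 𝟙`, so any system of covers contains
`g`: it contains identities and is closed under cancelling `σ` (`splitEpis_le`). Conversely,
sections can be composed, tensored and lifted along weak pullbacks, so split epimorphisms are
themselves a system of covers (`isSystemOfCovers_splitEpis`).

If a span inequality `s ≤ t` is witnessed by a morphism defined on a cover `π` of the apex of `s`,
and `π` has a section, then precomposing the witness with the section gives a morphism of spans
`s ⟶ t`. Hence the cover order of the split epimorphisms is the order given by morphisms of spans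
(`coverOrder_splitEpis`). A cartesian bicategory of spans is determined by its span order, so
`SpanTilde C` and `SpanCover (splitEpis C) _` are equal, and the isomorphism is the one induced by
this equality.
-/

section SplitEpis

variable {C : Type u} [Category.{v} C] [CartesianMonoidalCategory C]

theorem isSystemOfCovers_splitEpis : IsSystemOfCovers (splitEpis C) where
  id_mem X := (inferInstance : IsSplitEpi (𝟙 X))
  comp_mem := by
    rintro X Y Z f g ⟨⟨s⟩⟩ ⟨⟨t⟩⟩
    exact ⟨⟨⟨t.section_ ≫ s.section_, by simp⟩⟩⟩
  prod_mem := by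
    rintro X Y Z W f g ⟨⟨s⟩⟩ ⟨⟨t⟩⟩
    exact ⟨⟨⟨s.section_ ⊗ₘ t.section_, by simp⟩⟩⟩
  weakPullback_mem := by
    rintro X Y Z f g c hc ⟨⟨s⟩⟩
    exact ⟨⟨⟨PullbackCone.IsWeakLimit.lift hc (𝟙 X) (f ≫ s.section_) (by simp), by simp⟩⟩⟩
  of_comp_mem := by
    rintro X Y Z f g ⟨⟨s⟩⟩
    exact ⟨⟨⟨s.section_ ≫ f, by simp⟩⟩⟩

theorem IsSystemOfCovers.splitEpis_le {S : MorphismProperty C} (hS : IsSystemOfCovers S) :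
    splitEpis C ≤ S := by
  rintro X Y g ⟨⟨s⟩⟩
  exact hS.of_comp_mem s.section_ g (s.id ▸ hS.id_mem Y)

end SplitEpis

section SpanOrders

variable {C : Type u} [Category.{v} C] [CartesianMonoidalCategory C] [HasWeakPullbacks C]

theorem SpanOrder.ext_of_le_iff {O P : SpanOrder C}
    (h : ∀ {X Y : C} (s t : PlainSpan X Y), O.le s t ↔ P.le s t) : O = P := by
  have hle : @SpanOrder.le _ _ _ _ O = @SpanOrder.le _ _ _ _ P := by
    funext X Y s t
    exact propext (h s t)
  cases O
  cases P
  cases hle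
  rfl

/-- Precomposing with a section of the cover turns a morphism defined on a cover into a morphism of
spans. -/
theorem coverOrder_splitEpis (hS : IsSystemOfCovers (splitEpis C)) :
    coverOrder (splitEpis C) hS = tildeOrder C := by
  refine SpanOrder.ext_of_le_iff fun s t => ⟨?_, (coverOrder _ hS).le_of_hom⟩
  rintro ⟨A, π, a, ⟨⟨σ⟩⟩, hl, hr⟩
  exact ⟨⟨σ.section_ ≫ a, by simp [hl], by simp [hr]⟩⟩

end SpanOrders

theorem mainTheorem10 (C : Type u) [Category.{v} C] [CartesianMonoidalCategory C]
    [HasWeakPullbacks C] :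
    ∃ h : IsLeast {S : MorphismProperty C | IsSystemOfCovers S} (splitEpis C),
      Nonempty (SpanTilde C ≅ SpanCover (splitEpis C) h.1) := by
  refine ⟨⟨isSystemOfCovers_splitEpis, fun S hS => hS.splitEpis_le⟩, ⟨eqToIso ?_⟩⟩
  rw [SpanTilde, SpanCover, coverOrder_splitEpis]
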